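/- Let $q$ be a prime power and let $G$ be the $q\times q$ Reed--Solomon kernel over $\mathbb{F}_q$: its columns are indexed by the elements $a\in\mathbb{F}_q$, and its row $i\in\{0,\dots,q-1\}$ is $(a^{q-1-i})_{a\in\mathbb{F}_q}$ (with $0^0=1$). For $n\ge 0$ put $N=q^n$ and consider the polar transform $u\mapsto uG^{\otimes n}$ of $\mathbb{F}_q^N$, whose input coordinates are ordered lexicographically by their $n$ base-$q$ digits. Let $x\in[0,1]$, and let each of the $N$ symbols of $uG^{\otimes n}$ be erased independently with probability $x$ ($q$-ary erasure channel). The erasure rate of the $j$-th effective channel is the probability that $u_j$ is not determined by the preceding inputs $(u_i)_{i<j}$ together with the unerased symbols of $uG^{\otimes n}$. Let $X_n$ be the erasure rate of an effective channel chosen uniformly at random among the $N$ effective channels; write $\mathbb{P}(\,\cdot\mid X_0=x)$ for probabilities over this choice when the underlying erasure probability is $x$. Then, for any $\gamma>0$, any $\beta\in(0,\tfrac12]$ and any $n$ with $N^{-\gamma}\le\tfrac34$, \[ \mathbb{P}\big(X_n\in[N^{-\gamma},1-N^{-\gamma}]\,\big|\,X_0=x\big)\le N^{\gamma\beta-\frac12+\frac{\ln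 6-\frac12\ln\beta+(\beta-\frac12)\ln 4}{\ln q}} \] and \[ \mathbb{P}\big(X_n\ge N^{-\gamma}\,\big|\,X_0=x\big)\le N^{\gamma\beta-\frac12+\frac{\ln 6-\frac12\ln\beta+(\beta-\frac12)\ln 4}{\ln q}}+\frac{x}{1-N^{-\gamma}}. \] -/

import Mathlib

open scoped Matrix

namespace RSPolar

variable (F : Type*) [Field F] [Fintype F]

/-- The `q × q` Reed–Solomon kernel over the field `F` with `q` elements. Columns are indexed by the
elements of `F` (the evaluation points), and row `i ∈ {0, …, q-1}` is the vector of evaluations of the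
monomial `X ^ (q - 1 - i)`; the last row is the all-ones vector. For `q = 2` this is the matrix
`[[1, 0], [1, 1]]`, with the columns in the order `1, 0`. -/
def kernel : Matrix (Fin (Fintype.card F)) F F :=
  Matrix.of fun i a => a ^ (Fintype.card F - 1 - (i : ℕ))

/-- The polar transform of blocklength `N = q ^ n`: the `n`-fold Kronecker power of the kernel.
Row and column indices are written through their `n` digits. -/
def transform (n : ℕ) : Matrix (Fin n → Fin (Fintype.card F)) (Fin n → F) F :=
  Matrix.of fun i a => ∏ k, kernel F (i k) (a k)

variable {F}

/-- The codeword symbols in `E` are erased. The input symbol of index `j` is erased (for successive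
cancellation decoding) if it is not determined by the inputs of smaller index (in the lexicographic order
of the digits) together with the unerased symbols of the codeword `u G`. As the transform is linear, this
does not depend on the transmitted word. -/
def InputErased {n : ℕ} (E : Finset (Fin n → F)) (j : Fin n → Fin (Fintype.card F)) : Prop :=
  ∃ u u' : (Fin n → Fin (Fintype.card F)) → F,
    (∀ i, toLex i < toLex j → u i = u' i) ∧
    (∀ a, a ∉ E → (u ᵥ* transform F n) a = (u' ᵥ* transform F n) a) ∧
    u j ≠ u' j

open Classical in
/-- The erasure rate of the effective channel `j` after `n` polarization steps, i.e. the probability that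
the input symbol `j` is erased, when each of the `q ^ n` codeword symbols is sent over a `q`-ary erasure
channel with erasure probability `x`, independently. -/
noncomputable def erasureRate (n : ℕ) (x : ℝ) (j : Fin n → Fin (Fintype.card F)) : ℝ :=
  ∑ E : Finset (Fin n → F),
    x ^ E.card * (1 - x) ^ Eᶜ.card * (if InputErased E j then 1 else 0)

variable (F)

/-- `ℙ (X_n ∈ A | X_0 = x)`, where `X_n` is the erasure rate of an effective channel chosen uniformly at
random among the `q ^ n` effective channels after `n` polarization steps. -/
noncomputable def prob (n : ℕ) (x : ℝ) (A : Set ℝ) : ℝ :=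
  (Nat.card {j : Fin n → Fin (Fintype.card F) // erasureRate (F := F) n x j ∈ A} : ℝ) /
    (Fintype.card F : ℝ) ^ n

end RSPolar

/-!
A combination of the rows `i, …, q - 1` of the kernel is a polynomial of degree at most `q - 1 - i`,
and it is determined by any `q - i` of its values. Hence the input digit `i` of a single kernel is
erased exactly when more than `i` of its `q` output symbols are, and one polarization step with
first digit `i` replaces the erasure probability `x` by `Zᵢ = ℙ(Bin(q, x) > i)`.

The mean of the `Zᵢ` is `x`, so `Xₙ` is a martingale. The mean of `(Zᵢ (1 - Zᵢ)) ^ β` is at most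
`3 * 4 ^ β / √(β q)` times `(x (1 - x)) ^ β`. With `v = q x (1 - x)`: if `β v` is large, Chernoff's
bound makes `Zᵢ (1 - Zᵢ)` decay exponentially in the distance of `i` from the mean `q x`, on the
scale `√v`; if `v` is small, then, up to the symmetry `x ↦ 1 - x`, the mean `q x` is small and `Zᵢ`
decays geometrically. If the asserted factor is at least `1`, Jensen's inequality suffices.

Markov's inequality for `(Xₙ (1 - Xₙ)) ^ β` gives the first bound, and Markov's inequality for the
martingale `Xₙ` itself bounds the remaining probability that `Xₙ` is at least `1 - N ^ (-γ)`.
-/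

namespace RSPolar

open Finset Real

section Binomial

variable {m k l : ℕ} {x : ℝ}

/-- The probability that a binomial random variable with `m` trials and success probability `x`
equals `l`. -/
noncomputable def binomialWeight (m l : ℕ) (x : ℝ) : ℝ :=
  (bernsteinPolynomial ℝ m l).eval x

/-- The probability that a binomial random variable with `m` trials and success probability `x`
exceeds `k`. -/
noncomputable def binomialTail (m k : ℕ) (x : ℝ) : ℝ :=
  ∑ l ∈ range (m + 1) with k < l, binomialWeight m l x

lemma binomialWeight_eq (m l : ℕ) (x : ℝ) :
    binomialWeight m l x = m.choose l * x ^ l * (1 - x) ^ (m - l) := by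
  simp [binomialWeight, bernsteinPolynomial]

lemma binomialWeight_nonneg (hx : x ∈ Set.Icc (0 : ℝ) 1) : 0 ≤ binomialWeight m l x := by
  have hx0 : 0 ≤ x := hx.1
  have hx1 : 0 ≤ 1 - x := sub_nonneg.2 hx.2
  rw [binomialWeight_eq]
  positivity

lemma sum_binomialWeight_mul_pow (m : ℕ) (x z : ℝ) :
    ∑ l ∈ range (m + 1), binomialWeight m l x * z ^ l = (x * z + (1 - x)) ^ m := by
  rw [add_pow]
  refine sum_congr rfl fun l _ => ?_
  rw [binomialWeight_eq, mul_pow]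
  ring

lemma sum_binomialWeight (m : ℕ) (x : ℝ) : ∑ l ∈ range (m + 1), binomialWeight m l x = 1 := by
  simpa using sum_binomialWeight_mul_pow m x 1

lemma sum_binomialWeight_mul_self (m : ℕ) (x : ℝ) :
    ∑ l ∈ range (m + 1), binomialWeight m l x * l = m * x := by
  have h := congrArg (Polynomial.eval x) (bernsteinPolynomial.sum_smul ℝ m)
  simpa [Polynomial.eval_finsetSum, binomialWeight, mul_comm] using h

lemma binomialWeight_one_sub (hl : l ≤ m) :
    binomialWeight m l (1 - x) = binomialWeight m (m - l) x := by
  rw [binomialWeight, binomialWeight, ← bernsteinPolynomial.flip ℝ m l hl]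
  simp [Polynomial.eval_comp]

lemma binomialTail_add_sum_not (m k : ℕ) (x : ℝ) :
    binomialTail m k x + ∑ l ∈ range (m + 1) with ¬ k < l, binomialWeight m l x = 1 := by
  rw [binomialTail, sum_filter_add_sum_filter_not, sum_binomialWeight]

lemma binomialTail_mem_Icc (hx : x ∈ Set.Icc (0 : ℝ) 1) :
    binomialTail m k x ∈ Set.Icc (0 : ℝ) 1 := by
  refine ⟨sum_nonneg fun l _ => binomialWeight_nonneg hx, ?_⟩
  rw [← binomialTail_add_sum_not m k x]
  exact le_add_of_nonneg_right (sum_nonneg fun l _ => binomialWeight_nonneg hx)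

lemma sum_binomialTail (m : ℕ) (x : ℝ) : ∑ k ∈ range m, binomialTail m k x = m * x := by
  simp only [← sum_binomialWeight_mul_self, binomialTail, sum_filter]
  rw [sum_comm]
  refine sum_congr rfl fun l hl => ?_
  have hfilter : (range m).filter (· < l) = range l := by
    ext k
    simp only [mem_filter, mem_range] at hl ⊢
    omega
  rw [← sum_filter, hfilter, sum_const, card_range, nsmul_eq_mul, mul_comm]

lemma binomialTail_one_sub (hk : k < m) :
    binomialTail m k (1 - x) = 1 - binomialTail m (m - 1 - k) x := by
  refine eq_sub_of_add_eq' (Eq.trans ?_ (binomialTail_add_sum_not m (m - 1 - k) x))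
  congr 1
  refine sum_bij' (fun l _ => m - l) (fun l _ => m - l) ?_ ?_ ?_ ?_ fun l hl => ?_
  any_goals
    intro l hl
    simp only [mem_filter, mem_range] at hl ⊢
    omega
  exact binomialWeight_one_sub (Nat.lt_succ_iff.1 (mem_range.1 (mem_filter.1 hl).1))

lemma binomialTail_mul_le {f : ℕ → ℝ} (hf : Monotone f) (hf0 : ∀ l, 0 ≤ f l)
    (hx : x ∈ Set.Icc (0 : ℝ) 1) :
    binomialTail m k x * f (k + 1) ≤ ∑ l ∈ range (m + 1), binomialWeight m l x * f l := by
  rw [binomialTail, sum_mul]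
  calc ∑ l ∈ range (m + 1) with k < l, binomialWeight m l x * f (k + 1)
      ≤ ∑ l ∈ range (m + 1) with k < l, binomialWeight m l x * f l :=
        sum_le_sum fun l hl => mul_le_mul_of_nonneg_left (hf (mem_filter.1 hl).2)
          (binomialWeight_nonneg hx)
    _ ≤ ∑ l ∈ range (m + 1), binomialWeight m l x * f l :=
        sum_le_sum_of_subset_of_nonneg (filter_subset _ _) fun l _ _ =>
          mul_nonneg (binomialWeight_nonneg hx) (hf0 l)

lemma centered_bernoulli_mgf_le (hx : x ∈ Set.Icc (0 : ℝ) 1) {t : ℝ} (ht : |t| ≤ 1) :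
    x * exp (t * (1 - x)) + (1 - x) * exp (-(t * x)) ≤ exp (x * (1 - x) * t ^ 2) := by
  obtain ⟨hx0, hx1⟩ := hx
  have hx1' : 0 ≤ 1 - x := sub_nonneg.2 hx1
  have exp_le_quadratic : ∀ w : ℝ, |w| ≤ 1 → exp w ≤ 1 + w + w ^ 2 := fun w hw => by
    linarith [(abs_le.1 (abs_exp_sub_one_sub_id_le hw)).2]
  have h_success : |t * (1 - x)| ≤ 1 := by
    rw [abs_mul, abs_of_nonneg hx1']
    exact mul_le_one₀ ht hx1' (by linarith)
  have h_failure : |-(t * x)| ≤ 1 := by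
    rw [abs_neg, abs_mul, abs_of_nonneg hx0]
    exact mul_le_one₀ ht hx0 hx1
  calc x * exp (t * (1 - x)) + (1 - x) * exp (-(t * x))
      ≤ x * (1 + t * (1 - x) + (t * (1 - x)) ^ 2) +
          (1 - x) * (1 + -(t * x) + (-(t * x)) ^ 2) := by
        gcongr
        exacts [exp_le_quadratic _ h_success, exp_le_quadratic _ h_failure]
    _ = x * (1 - x) * t ^ 2 + 1 := by ring
    _ ≤ exp (x * (1 - x) * t ^ 2) := add_one_le_exp _

lemma centered_binomial_mgf_le (hx : x ∈ Set.Icc (0 : ℝ) 1) {t : ℝ} (ht : |t| ≤ 1) :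
    ∑ l ∈ range (m + 1), binomialWeight m l x * exp (t * (l - m * x)) ≤
      exp (m * (x * (1 - x)) * t ^ 2) := by
  have hx0 : 0 ≤ x := hx.1
  have hx1 : 0 ≤ 1 - x := sub_nonneg.2 hx.2
  have hpow : ∑ l ∈ range (m + 1), binomialWeight m l x * exp (t * (l - m * x)) =
      (x * exp (t * (1 - x)) + (1 - x) * exp (-(t * x))) ^ m := by
    rw [show x * exp (t * (1 - x)) + (1 - x) * exp (-(t * x)) =
        (x * exp t + (1 - x)) * exp (-(t * x)) by
      rw [mul_one_sub, sub_eq_add_neg, exp_add]; ring]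
    rw [mul_pow, ← sum_binomialWeight_mul_pow, sum_mul]
    refine sum_congr rfl fun l _ => ?_
    rw [mul_assoc, ← exp_nat_mul, ← exp_nat_mul, ← exp_add]
    ring_nf
  rw [hpow, mul_assoc, exp_nat_mul]
  exact pow_le_pow_left₀ (by positivity) (centered_bernoulli_mgf_le hx ht) m

lemma binomialTail_le_exp (hx : x ∈ Set.Icc (0 : ℝ) 1) {t : ℝ} (ht : t ∈ Set.Icc (0 : ℝ) 1) :
    binomialTail m k x ≤ exp (m * (x * (1 - x)) * t ^ 2 - t * (k + 1 - m * x)) := by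
  have hmono : Monotone fun l : ℕ => exp (t * (l - m * x)) := fun a b hab => by
    have ht0 := ht.1
    dsimp only
    gcongr
  have hmarkov := (binomialTail_mul_le (m := m) (k := k) hmono (fun _ => (exp_pos _).le) hx).trans
    (centered_binomial_mgf_le hx (by rw [abs_of_nonneg ht.1]; exact ht.2))
  rwa [exp_sub, le_div_iff₀ (exp_pos _), ← Nat.cast_succ]

lemma binomialTail_mul_one_sub_nonneg (hx : x ∈ Set.Icc (0 : ℝ) 1) :
    0 ≤ binomialTail m k x * (1 - binomialTail m k x) :=
  mul_nonneg (binomialTail_mem_Icc hx).1 (sub_nonneg.2 (binomialTail_mem_Icc hx).2)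

lemma binomialTail_mul_one_sub_le_exp (hx : x ∈ Set.Icc (0 : ℝ) 1) {t : ℝ}
    (ht : t ∈ Set.Icc (0 : ℝ) 1) (hk : k < m) :
    binomialTail m k x * (1 - binomialTail m k x) ≤
      exp (m * (x * (1 - x)) * t ^ 2 - t * max (k + 1 - m * x) (m * x - k)) := by
  obtain ⟨hZ0, hZ1⟩ := binomialTail_mem_Icc (m := m) (k := k) hx
  rcases le_total (m * x - k) (k + 1 - m * x) with h | h
  · rw [max_eq_left h]
    exact (mul_le_of_le_one_right hZ0 (by linarith)).trans (binomialTail_le_exp hx ht)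
  · have hreflect : 1 - binomialTail m k x = binomialTail m (m - 1 - k) (1 - x) := by
      rw [binomialTail_one_sub (by omega), Nat.sub_sub_self (by omega)]
    have hcast : ((m - 1 - k : ℕ) : ℝ) = m - 1 - k := by
      rw [Nat.cast_sub (by omega), Nat.cast_sub (by omega), Nat.cast_one]
    rw [max_eq_right h]
    refine (mul_le_of_le_one_left (by linarith) hZ1).trans ?_
    rw [hreflect]
    refine (binomialTail_le_exp (Set.Icc.one_sub_mem hx) ht).trans_eq ?_
    rw [hcast]
    ring_nf

lemma binomialTail_mul_two_pow_sub_one_le (hx : x ∈ Set.Icc (0 : ℝ) 1) :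
    binomialTail m k x * (2 ^ (k + 1) - 1) ≤ exp (m * x) - 1 := by
  have hmono : Monotone fun l : ℕ => (2 : ℝ) ^ l - 1 := fun a b hab => by
    dsimp only
    gcongr
    norm_num
  calc binomialTail m k x * (2 ^ (k + 1) - 1)
      ≤ ∑ l ∈ range (m + 1), binomialWeight m l x * ((2 : ℝ) ^ l - 1) :=
        binomialTail_mul_le hmono (fun l => sub_nonneg.2 (one_le_pow₀ one_le_two)) hx
    _ = (x + 1) ^ m - 1 := by
        simp only [mul_sub_one, sum_sub_distrib, sum_binomialWeight_mul_pow, sum_binomialWeight]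
        ring
    _ ≤ exp (m * x) - 1 := by
        rw [exp_nat_mul]
        gcongr
        · linarith [hx.1]
        · exact add_one_le_exp x

end Binomial

section Exponential

lemma geom_sum_le_inv_one_sub {r : ℝ} (h0 : 0 ≤ r) (h1 : r < 1) (n : ℕ) :
    ∑ i ∈ range n, r ^ i ≤ (1 - r)⁻¹ := by
  rw [← tsum_geometric_of_lt_one h0 h1]
  exact (summable_geometric_of_lt_one h0 h1).sum_le_tsum _ fun i _ => pow_nonneg h0 i

lemma sum_exp_neg_mul_max_le {a : ℝ} (ha : 0 < a) (c : ℝ) (n : ℕ) :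
    ∑ i ∈ range n, exp (-(a * max (i + 1 - c) (c - i))) ≤ (1 + exp (-a)) / (1 - exp (-a)) := by
  set p := ⌊c⌋₊
  have hr0 : 0 ≤ exp (-a) := (exp_pos _).le
  have hr1 : exp (-a) < 1 := exp_lt_one_iff.2 (neg_lt_zero.2 ha)
  have term_le : ∀ (i k : ℕ), (k : ℝ) ≤ max (i + 1 - c) (c - i) →
      exp (-(a * max (i + 1 - c) (c - i))) ≤ exp (-a) ^ k := fun i k hk => by
    rw [← exp_nat_mul, exp_le_exp]
    linarith [mul_le_mul_of_nonneg_left hk ha.le]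
  have left_le : ∑ i ∈ range p, exp (-(a * max (i + 1 - c) (c - i))) ≤
      exp (-a) * (1 - exp (-a))⁻¹ := by
    rw [← sum_range_reflect]
    refine (sum_le_sum fun j hj => term_le _ (j + 1) (le_max_of_le_right ?_)).trans ?_
    · have hj' : j < p := mem_range.1 hj
      have hpc : (p : ℝ) ≤ c := (Nat.le_floor_iff' (by omega)).1 le_rfl
      rw [Nat.cast_sub (by omega), Nat.cast_sub (by omega)]
      push_cast
      linarith
    · simp only [pow_succ', ← mul_sum]
      exact mul_le_mul_of_nonneg_left (geom_sum_le_inv_one_sub hr0 hr1 p) hr0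
  have right_le : ∑ i ∈ range n, exp (-(a * max ((p + i : ℕ) + 1 - c) (c - (p + i : ℕ)))) ≤
      (1 - exp (-a))⁻¹ := by
    refine (sum_le_sum fun i _ => term_le _ i (le_max_of_le_left ?_)).trans
      (geom_sum_le_inv_one_sub hr0 hr1 n)
    push_cast
    linarith [Nat.lt_floor_add_one c]
  calc ∑ i ∈ range n, exp (-(a * max (i + 1 - c) (c - i)))
      ≤ ∑ i ∈ range (p + n), exp (-(a * max (i + 1 - c) (c - i))) :=
        sum_le_sum_of_subset_of_nonneg (range_mono (Nat.le_add_left n p))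
          fun i _ _ => (exp_pos _).le
    _ ≤ exp (-a) * (1 - exp (-a))⁻¹ + (1 - exp (-a))⁻¹ := by
        rw [sum_range_add]
        exact add_le_add left_le right_le
    _ = (1 + exp (-a)) / (1 - exp (-a)) := by
        rw [div_eq_mul_inv]
        ring

lemma one_add_exp_neg_div_one_sub_exp_neg_le {a : ℝ} (h0 : 0 < a) (h1 : a ≤ 1 / 2) :
    (1 + exp (-a)) / (1 - exp (-a)) ≤ 13 / (6 * a) := by
  have hr1 : exp (-a) < 1 := exp_lt_one_iff.2 (neg_lt_zero.2 h0)
  have hinv : exp (-a) * exp a = 1 := by rw [← exp_add, neg_add_cancel, exp_zero]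
  have hcleared : 6 * a + 13 ≤ (13 - 6 * a) * exp a := by
    refine le_trans ?_ (mul_le_mul_of_nonneg_left (quadratic_le_exp_of_nonneg h0.le) (by linarith))
    nlinarith [mul_pos h0 h0, mul_nonneg h0.le (mul_nonneg h0.le (sub_nonneg.2 h1))]
  rw [div_le_div_iff₀ (sub_pos.2 hr1) (by positivity)]
  linear_combination exp (-a) * hcleared + (13 - 6 * a) * hinv

lemma log_four_eq : log 4 = 2 * log 2 := by
  rw [show (4 : ℝ) = 2 ^ 2 by norm_num, log_pow, Nat.cast_ofNat]

lemma exp_one_quarter_le : exp (1 / 4) ≤ 4 / 3 :=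
  (exp_bound_div_one_sub_of_interval (by norm_num) (by norm_num)).trans_eq (by norm_num)

lemma exp_sub_one_le_two_mul {y : ℝ} (h0 : 0 ≤ y) (h1 : y ≤ 9 / 8) : exp y - 1 ≤ 2 * y := by
  have endpoint : exp (9 / 8) ≤ 13 / 4 := by
    have h8 : exp (1 / 8) ≤ 8 / 7 :=
      (exp_bound_div_one_sub_of_interval (by norm_num) (by norm_num)).trans_eq (by norm_num)
    calc exp (9 / 8) = exp 1 * exp (1 / 8) := by rw [← exp_add]; norm_num
      _ ≤ 2.7182818286 * (8 / 7) := by gcongr; exact exp_one_lt_d9.le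
      _ ≤ 13 / 4 := by norm_num
  have chord := convexOn_exp.2 (Set.mem_univ (0 : ℝ)) (Set.mem_univ (9 / 8 : ℝ))
    (by linarith : 0 ≤ 1 - 8 / 9 * y) (by linarith : 0 ≤ 8 / 9 * y) (by ring)
  simp only [smul_eq_mul, mul_zero, zero_add, exp_zero,
    show 8 / 9 * y * (9 / 8) = y by ring] at chord
  nlinarith

end Exponential

section Potential

variable {m : ℕ} {x β : ℝ}

/-- The Lyapunov function whose average over the effective channels contracts in each
polarization step. -/
noncomputable def potential (β x : ℝ) : ℝ := (x * (1 - x)) ^ β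

lemma potential_nonneg (hx : x ∈ Set.Icc (0 : ℝ) 1) : 0 ≤ potential β x :=
  rpow_nonneg (mul_nonneg hx.1 (sub_nonneg.2 hx.2)) β

lemma potential_one_sub (β x : ℝ) : potential β (1 - x) = potential β x := by
  rw [potential, potential, sub_sub_cancel, mul_comm]

lemma potential_le_one_quarter_rpow (hx : x ∈ Set.Icc (0 : ℝ) 1) (h0 : 0 ≤ β) :
    potential β x ≤ (1 / 4) ^ β :=
  rpow_le_rpow (mul_nonneg hx.1 (sub_nonneg.2 hx.2)) (by nlinarith [sq_nonneg (2 * x - 1)]) h0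

lemma div_four_rpow_le_potential {δ : ℝ} (hδ0 : 0 ≤ δ) (hδ : δ ≤ 3 / 4)
    (hx : x ∈ Set.Icc δ (1 - δ)) (h0 : 0 ≤ β) : (δ / 4) ^ β ≤ potential β x := by
  refine rpow_le_rpow (by positivity) ?_ h0
  nlinarith [mul_nonneg (sub_nonneg.2 hx.1) (sub_nonneg.2 hx.2)]

lemma sum_potential_binomialTail_one_sub (m : ℕ) (β x : ℝ) :
    ∑ i ∈ range m, potential β (binomialTail m i (1 - x)) =
      ∑ i ∈ range m, potential β (binomialTail m i x) := by
  rw [← sum_range_reflect (fun i => potential β (binomialTail m i x))]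
  refine sum_congr rfl fun i hi => ?_
  rw [binomialTail_one_sub (mem_range.1 hi), potential_one_sub]

lemma sum_binomialTail_mul_one_sub_le (m : ℕ) (x : ℝ) :
    ∑ i ∈ range m, binomialTail m i x * (1 - binomialTail m i x) ≤ m * (x * (1 - x)) := by
  rcases m.eq_zero_or_pos with rfl | hm
  · simp
  have hm' : (0 : ℝ) < m := Nat.cast_pos.2 hm
  have cauchy_schwarz : (m * x) ^ 2 ≤ m * ∑ i ∈ range m, binomialTail m i x ^ 2 := by
    simpa [sum_binomialTail] using
      sq_sum_le_card_mul_sum_sq (s := range m) (f := fun i => binomialTail m i x)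
  have second_moment : m * x ^ 2 ≤ ∑ i ∈ range m, binomialTail m i x ^ 2 :=
    le_of_mul_le_mul_left (by linarith) hm'
  simp only [mul_one_sub, ← sq, sum_sub_distrib, sum_binomialTail]
  linarith

lemma sum_potential_binomialTail_le_mul (hx : x ∈ Set.Icc (0 : ℝ) 1) (h0 : 0 ≤ β) (h1 : β ≤ 1) :
    ∑ i ∈ range m, potential β (binomialTail m i x) ≤ m * potential β x := by
  rcases m.eq_zero_or_pos with rfl | hm
  · simp
  have hm' : (0 : ℝ) < m := Nat.cast_pos.2 hm
  have jensen := (concaveOn_rpow h0 h1).le_map_sum (t := range m) (w := fun _ => (m : ℝ)⁻¹)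
    (p := fun i => binomialTail m i x * (1 - binomialTail m i x))
    (fun _ _ => by positivity) (by simp [hm'.ne'])
    (fun i _ => binomialTail_mul_one_sub_nonneg hx)
  simp only [smul_eq_mul, ← mul_sum] at jensen
  rw [← inv_mul_le_iff₀ hm']
  refine jensen.trans (rpow_le_rpow ?_ ?_ h0)
  · exact mul_nonneg (by positivity) (sum_nonneg fun i _ => binomialTail_mul_one_sub_nonneg hx)
  · rw [inv_mul_le_iff₀ hm']
    exact sum_binomialTail_mul_one_sub_le m x

lemma sum_potential_binomialTail_le_exp (hx : x ∈ Set.Icc (0 : ℝ) 1) (h0 : 0 < β)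
    (h1 : β ≤ 1 / 2) {t : ℝ} (ht0 : 0 < t) (ht1 : t ≤ 1) :
    ∑ i ∈ range m, potential β (binomialTail m i x) ≤
      exp (β * (m * (x * (1 - x))) * t ^ 2) * (13 / (6 * (β * t))) := by
  have term_le : ∀ i ∈ range m, potential β (binomialTail m i x) ≤
      exp (β * (m * (x * (1 - x))) * t ^ 2) *
        exp (-(β * t * max (i + 1 - m * x) (m * x - i))) := fun i hi => by
    have h := rpow_le_rpow (binomialTail_mul_one_sub_nonneg hx)
      (binomialTail_mul_one_sub_le_exp hx ⟨ht0.le, ht1⟩ (mem_range.1 hi)) h0.le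
    rw [← exp_mul] at h
    refine h.trans_eq ?_
    rw [← exp_add]
    ring_nf
  refine (sum_le_sum term_le).trans ?_
  rw [← mul_sum]
  gcongr
  refine (sum_exp_neg_mul_max_le (mul_pos h0 ht0) _ m).trans ?_
  exact one_add_exp_neg_div_one_sub_exp_neg_le (mul_pos h0 ht0) (by nlinarith)

lemma sum_potential_binomialTail_le_of_large_variance (hx : x ∈ Set.Icc (0 : ℝ) 1) (h0 : 0 < β)
    (h1 : β ≤ 1 / 2) (hv : 1 / 4 ≤ β * (m * (x * (1 - x)))) :
    ∑ i ∈ range m, potential β (binomialTail m i x) ≤ 6 * √(β * (m * (x * (1 - x)))) / β := by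
  obtain ⟨w, hw, hwv⟩ : ∃ w, √(β * (m * (x * (1 - x)))) = w ∧ β * (m * (x * (1 - x))) = w ^ 2 :=
    ⟨_, rfl, (sq_sqrt (by linarith)).symm⟩
  have hw2 : 1 / 2 ≤ w := hw ▸ le_sqrt_of_sq_le (by linarith)
  rw [hw]
  -- The Chernoff parameter `t = 1 / (2 * w)` makes `w ^ 2 * t ^ 2 = 1 / 4`.
  calc ∑ i ∈ range m, potential β (binomialTail m i x)
      ≤ exp (β * (m * (x * (1 - x))) * (1 / (2 * w)) ^ 2) * (13 / (6 * (β * (1 / (2 * w))))) :=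
        sum_potential_binomialTail_le_exp hx h0 h1 (by positivity)
          (by rw [div_le_one (by positivity)]; linarith)
    _ = exp (1 / 4) * (13 / 3 * (w / β)) := by
        rw [hwv]
        congr 2 <;> field_simp <;> norm_num
    _ ≤ 4 / 3 * (13 / 3 * (w / β)) := by
        gcongr
        exact exp_one_quarter_le
    _ = 52 / 9 * (w / β) := by ring
    _ ≤ 6 * (w / β) := by gcongr; norm_num
    _ = 6 * w / β := by ring

lemma sum_potential_binomialTail_le_of_variance_le (hx : x ∈ Set.Icc (0 : ℝ) 1) (h0 : 0 < β)
    (h1 : β ≤ 1 / 2) (hv : β * (m * (x * (1 - x))) ≤ 1 / 4) :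
    ∑ i ∈ range m, potential β (binomialTail m i x) ≤ 3 / β := by
  calc ∑ i ∈ range m, potential β (binomialTail m i x)
      ≤ exp (β * (m * (x * (1 - x))) * 1 ^ 2) * (13 / (6 * (β * 1))) :=
        sum_potential_binomialTail_le_exp hx h0 h1 one_pos le_rfl
    _ ≤ 4 / 3 * (13 / (6 * (β * 1))) := by
        gcongr
        exact (exp_le_exp.2 (by linarith)).trans exp_one_quarter_le
    _ = 26 / 9 / β := by field_simp; norm_num
    _ ≤ 3 / β := by gcongr; norm_num

lemma binomialTail_le_geometric (hx : x ∈ Set.Icc (0 : ℝ) 1) (hm : m * x ≤ 9 / 8) (i : ℕ) :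
    binomialTail m i x ≤ 2 * (m * x) * (1 / 2) ^ i := by
  have hZ0 := (binomialTail_mem_Icc (m := m) (k := i) hx).1
  have hpow : (1 : ℝ) ≤ 2 ^ i := one_le_pow₀ one_le_two
  rw [one_div, inv_pow, ← div_eq_mul_inv, le_div_iff₀ (by positivity)]
  calc binomialTail m i x * 2 ^ i ≤ binomialTail m i x * (2 ^ (i + 1) - 1) :=
        mul_le_mul_of_nonneg_left (by rw [pow_succ]; linarith) hZ0
    _ ≤ exp (m * x) - 1 := binomialTail_mul_two_pow_sub_one_le hx
    _ ≤ 2 * (m * x) :=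
        exp_sub_one_le_two_mul (mul_nonneg (Nat.cast_nonneg m) hx.1) hm

lemma inv_one_sub_one_half_rpow_le (h0 : 0 < β) (h1 : β ≤ 1) : (1 - (1 / 2) ^ β)⁻¹ ≤ 2 / β := by
  have bernoulli := rpow_one_add_le_one_add_mul_self (s := -(1 / 2)) (by norm_num) h0.le h1
  rw [show (1 : ℝ) + -(1 / 2) = 1 / 2 by norm_num] at bernoulli
  rw [inv_le_comm₀ (by linarith) (by positivity), inv_div]
  linarith

lemma sum_potential_binomialTail_le_of_small_mean (hx : x ∈ Set.Icc (0 : ℝ) 1) (h0 : 0 < β)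
    (h1 : β ≤ 1) (hm : m * x ≤ 9 / 8) :
    ∑ i ∈ range m, potential β (binomialTail m i x) ≤ (2 * (m * x)) ^ β * (2 / β) := by
  have hμ : 0 ≤ 2 * (m * x) := mul_nonneg two_pos.le (mul_nonneg (Nat.cast_nonneg m) hx.1)
  have term_le : ∀ i ∈ range m, potential β (binomialTail m i x) ≤
      (2 * (m * x)) ^ β * ((1 / 2) ^ β) ^ i := fun i _ => by
    have hZ0 := (binomialTail_mem_Icc (m := m) (k := i) hx).1
    rw [rpow_pow_comm (by norm_num), ← mul_rpow hμ (by positivity)]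
    refine rpow_le_rpow (binomialTail_mul_one_sub_nonneg hx) ?_ h0.le
    exact (mul_le_of_le_one_right hZ0 (by linarith)).trans (binomialTail_le_geometric hx hm i)
  refine (sum_le_sum term_le).trans ?_
  rw [← mul_sum]
  gcongr
  have hr1 : (1 / 2 : ℝ) ^ β < 1 := rpow_lt_one (by norm_num) (by norm_num) h0
  exact (geom_sum_le_inv_one_sub (by positivity) hr1 m).trans (inv_one_sub_one_half_rpow_le h0 h1)

lemma sum_potential_binomialTail_le_of_small_variance_of_le_half (hx : x ∈ Set.Icc (0 : ℝ) (1 / 2))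
    (h0 : 0 < β) (h1 : β ≤ 1 / 2) (hm : (18 : ℝ) ≤ m) (hv : m * (x * (1 - x)) ≤ 1) :
    ∑ i ∈ range m, potential β (binomialTail m i x) ≤ 3 / β * (m * (x * (1 - x))) ^ β := by
  obtain ⟨hx0, hx2⟩ := hx
  have hx9 : x ≤ 1 / 9 := by nlinarith [mul_nonneg hx0 (by linarith : (0 : ℝ) ≤ 1 - x)]
  have hv0 : 0 ≤ m * (x * (1 - x)) := by
    have : 0 ≤ 1 - x := by linarith
    positivity
  have mean_le : m * x ≤ 9 / 8 * (m * (x * (1 - x))) := by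
    have hmx : 0 ≤ m * x := by positivity
    linarith [mul_le_mul_of_nonneg_left hx9 hmx]
  have const_le : (9 / 4 : ℝ) ^ β ≤ 3 / 2 :=
    calc (9 / 4 : ℝ) ^ β ≤ (9 / 4 : ℝ) ^ (1 / 2 : ℝ) :=
          rpow_le_rpow_of_exponent_le (by norm_num) h1
      _ = 3 / 2 := by
          rw [← sqrt_eq_rpow, show (9 / 4 : ℝ) = (3 / 2) ^ 2 by norm_num, sqrt_sq (by norm_num)]
  calc ∑ i ∈ range m, potential β (binomialTail m i x)
      ≤ (2 * (m * x)) ^ β * (2 / β) := sum_potential_binomialTail_le_of_small_mean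
        ⟨hx0, by linarith⟩ h0 (by linarith) (by linarith)
    _ ≤ (9 / 4 * (m * (x * (1 - x)))) ^ β * (2 / β) := by
        refine mul_le_mul_of_nonneg_right (rpow_le_rpow ?_ (by linarith) h0.le) (by positivity)
        positivity
    _ = (9 / 4) ^ β * (m * (x * (1 - x))) ^ β * (2 / β) := by rw [mul_rpow (by norm_num) hv0]
    _ ≤ 3 / 2 * (m * (x * (1 - x))) ^ β * (2 / β) := by gcongr
    _ = 3 / β * (m * (x * (1 - x))) ^ β := by ring

lemma sum_potential_binomialTail_le_of_small_variance (hx : x ∈ Set.Icc (0 : ℝ) 1)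
    (h0 : 0 < β) (h1 : β ≤ 1 / 2) (hm : (18 : ℝ) ≤ m) (hv : m * (x * (1 - x)) ≤ 1) :
    ∑ i ∈ range m, potential β (binomialTail m i x) ≤ 3 / β * (m * (x * (1 - x))) ^ β := by
  rcases le_total x (1 / 2) with hx2 | hx2
  · exact sum_potential_binomialTail_le_of_small_variance_of_le_half ⟨hx.1, hx2⟩ h0 h1 hm hv
  · have hsymm : (1 - x) * (1 - (1 - x)) = x * (1 - x) := by ring
    have := sum_potential_binomialTail_le_of_small_variance_of_le_half (m := m) (x := 1 - x)
      ⟨sub_nonneg.2 hx.2, by linarith⟩ h0 h1 hm (by rwa [hsymm])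
    rwa [sum_potential_binomialTail_one_sub, hsymm] at this

/-- A bound on the factor by which `potential β` contracts on average in one step with a `q × q`
kernel. -/
noncomputable def driftFactor (q β : ℝ) : ℝ :=
  3 * 4 ^ β / (√β * √q)

lemma driftFactor_nonneg (q β : ℝ) : 0 ≤ driftFactor q β := by
  rw [driftFactor]
  positivity

lemma mul_driftFactor (q β : ℝ) : q * driftFactor q β = 3 * 4 ^ β * √q / √β := by
  rw [driftFactor, mul_comm (√β), ← div_div, ← mul_div_assoc, mul_div_left_comm, div_sqrt]

lemma nine_le_mul_of_driftFactor_lt_one {q : ℝ} (hq : 0 < q) (h0 : 0 < β)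
    (h : driftFactor q β < 1) : 9 ≤ β * q := by
  rw [driftFactor, div_lt_one (by positivity), ← sqrt_mul h0.le] at h
  have hthree : 3 ≤ √(β * q) := by linarith [one_le_rpow (by norm_num : (1 : ℝ) ≤ 4) h0.le]
  have := (le_sqrt' (by norm_num)).1 hthree
  linarith

lemma six_mul_sqrt_div_le_mul_driftFactor {q : ℝ} (hq : 0 ≤ q) (h0 : 0 < β) (h1 : β ≤ 1 / 2)
    (hx : 0 < x * (1 - x)) :
    6 * √(β * (q * (x * (1 - x)))) / β ≤ q * driftFactor q β * potential β x := by
  have two_mul_sqrt_le : 2 * √(x * (1 - x)) ≤ 4 ^ β * potential β x :=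
    calc 2 * √(x * (1 - x)) = √(4 * (x * (1 - x))) := by
          rw [sqrt_mul zero_le_four, show (4 : ℝ) = 2 ^ 2 by norm_num, sqrt_sq two_pos.le]
      _ ≤ (4 * (x * (1 - x))) ^ β := by
          rw [sqrt_eq_rpow]
          exact rpow_le_rpow_of_exponent_ge (by linarith) (by nlinarith [sq_nonneg (2 * x - 1)]) h1
      _ = 4 ^ β * potential β x := mul_rpow (by norm_num) hx.le
  calc 6 * √(β * (q * (x * (1 - x)))) / β
      = 3 * √q * (√β / β) * (2 * √(x * (1 - x))) := by
        rw [sqrt_mul h0.le, sqrt_mul hq]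
        ring
    _ ≤ 3 * √q * (√β / β) * (4 ^ β * potential β x) := by gcongr
    _ = q * driftFactor q β * potential β x := by
        rw [mul_driftFactor, sqrt_div_self]
        ring

lemma rpow_le_four_rpow_mul_sqrt_mul_sqrt {q : ℝ} (h0 : 0 < β) (h1 : β ≤ 1 / 2)
    (hq : exp 1 ≤ β * q) : q ^ β ≤ 4 ^ β * √β * √q := by
  have hq0 : 0 < q := pos_of_mul_pos_right ((exp_pos 1).trans_le hq) h0.le
  have log_mul_ge : 1 ≤ log β + log q := by
    rw [← log_mul h0.ne' hq0.ne']
    exact (le_log_iff_exp_le (by positivity)).2 hq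
  have log_two_mul_ge : 1 - (2 * β)⁻¹ ≤ log 2 + log β := by
    rw [← log_mul two_ne_zero h0.ne']
    exact one_sub_inv_le_log_of_pos (by positivity)
  have mul_log_two_mul_ge : β - 1 / 2 ≤ β * (log 2 + log β) := by
    refine (mul_le_mul_of_nonneg_left log_two_mul_ge h0.le).trans_eq' ?_
    field_simp
  rw [← log_le_log_iff (by positivity) (by positivity), log_mul (by positivity) (by positivity),
    log_mul (by positivity) (by positivity), log_rpow hq0, log_rpow (by norm_num), log_sqrt hq0.le,
    log_sqrt h0.le, log_four_eq]
  linarith [mul_pos h0 (log_pos one_lt_two),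
    mul_le_mul_of_nonneg_left log_mul_ge (by linarith : (0 : ℝ) ≤ 1 / 2 - β)]

lemma three_div_mul_rpow_le_mul_driftFactor {q : ℝ} (hq : exp 1 ≤ β * q) (h0 : 0 < β)
    (h1 : β ≤ 1 / 2) (hx : 0 ≤ x * (1 - x)) :
    3 / β * (q * (x * (1 - x))) ^ β ≤ q * driftFactor q β * potential β x := by
  have hq0 : 0 < q := pos_of_mul_pos_right ((exp_pos 1).trans_le hq) h0.le
  have hpotential : 0 ≤ potential β x := rpow_nonneg hx β
  calc 3 / β * (q * (x * (1 - x))) ^ β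
      = 3 / β * (q ^ β * potential β x) := by rw [mul_rpow hq0.le hx, potential]
    _ ≤ 3 / β * (4 ^ β * √β * √q * potential β x) := by
        gcongr
        exact rpow_le_four_rpow_mul_sqrt_mul_sqrt h0 h1 hq
    _ = 3 * (√β / β) * 4 ^ β * √q * potential β x := by ring
    _ = q * driftFactor q β * potential β x := by
        rw [mul_driftFactor, sqrt_div_self]
        ring

lemma sum_potential_binomialTail_le_of_nine_le (hx : x ∈ Set.Icc (0 : ℝ) 1)
    (hpos : 0 < x * (1 - x)) (h0 : 0 < β) (h1 : β ≤ 1 / 2) (hm : 9 ≤ β * m) :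
    ∑ i ∈ range m, potential β (binomialTail m i x) ≤
      m * driftFactor m β * potential β x := by
  have hexp : exp 1 ≤ β * m := by linarith [exp_one_lt_three]
  rcases le_total (1 / 4) (β * (m * (x * (1 - x)))) with hv | hv
  · exact (sum_potential_binomialTail_le_of_large_variance hx h0 h1 hv).trans
      (six_mul_sqrt_div_le_mul_driftFactor (Nat.cast_nonneg m) h0 h1 hpos)
  refine le_trans ?_ (three_div_mul_rpow_le_mul_driftFactor hexp h0 h1 hpos.le)
  rcases le_total 1 (m * (x * (1 - x))) with hv1 | hv1
  · exact (sum_potential_binomialTail_le_of_variance_le hx h0 h1 hv).trans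
      (le_mul_of_one_le_right (by positivity) (one_le_rpow hv1 h0.le))
  · exact sum_potential_binomialTail_le_of_small_variance hx h0 h1 (by nlinarith) hv1

lemma sum_potential_binomialTail_le_driftFactor (hx : x ∈ Set.Icc (0 : ℝ) 1) (h0 : 0 < β)
    (h1 : β ≤ 1 / 2) :
    ∑ i ∈ range m, potential β (binomialTail m i x) ≤
      m * driftFactor m β * potential β x := by
  have jensen := sum_potential_binomialTail_le_mul (m := m) hx h0.le (by linarith)
  rcases m.eq_zero_or_pos with rfl | hm
  · simp
  rcases (mul_nonneg hx.1 (sub_nonneg.2 hx.2)).eq_or_lt with hzero | hpos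
  · have hpotential : potential β x = 0 := by rw [potential, ← hzero, zero_rpow h0.ne']
    rwa [hpotential, mul_zero] at jensen ⊢
  rcases le_or_gt 1 (driftFactor m β) with hfactor | hfactor
  · exact jensen.trans (mul_le_mul_of_nonneg_right
      (le_mul_of_one_le_right (Nat.cast_nonneg m) hfactor) (potential_nonneg hx))
  · exact sum_potential_binomialTail_le_of_nine_le hx hpos h0 h1
      (nine_le_mul_of_driftFactor_lt_one (Nat.cast_pos.2 hm) h0 hfactor)

end Potential

section Columns

variable {ι κ α R : Type*} [Fintype ι] [Fintype κ] [Fintype α] [CommSemiring R] {n : ℕ}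

/-- The probability that `E` is exactly the set of erased positions, when each position is erased
independently with probability `x`. -/
noncomputable def bernoulliWeight (x : ℝ) (E : Finset ι) : ℝ :=
  x ^ #E * (1 - x) ^ (Fintype.card ι - #E)

lemma prod_ite_mem_eq_bernoulliWeight [DecidableEq ι] (x : ℝ) (E : Finset ι) :
    ∏ a, (if a ∈ E then x else 1 - x) = bernoulliWeight x E := by
  rw [prod_ite, prod_const, prod_const, bernoulliWeight, filter_univ_mem, ← card_compl,
    compl_eq_univ_sdiff, sdiff_eq_filter]

lemma sum_bernoulliWeight_filter_card (P : ℕ → Prop) [DecidablePred P] (x : ℝ) :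
    ∑ D : Finset α with P #D, bernoulliWeight x D =
      ∑ l ∈ range (Fintype.card α + 1) with P l, binomialWeight (Fintype.card α) l x := by
  have h := sum_powerset_apply_card (x := (univ : Finset α))
    (fun l => if P l then x ^ l * (1 - x) ^ (Fintype.card α - l) else 0)
  rw [powerset_univ, card_univ] at h
  simp only [sum_filter, bernoulliWeight, binomialWeight_eq, h, nsmul_eq_mul, mul_ite, mul_zero,
    mul_assoc]

lemma sum_bernoulliWeight_card_gt (k : ℕ) (x : ℝ) :
    ∑ D : Finset α with k < #D, bernoulliWeight x D = binomialTail (Fintype.card α) k x :=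
  sum_bernoulliWeight_filter_card (k < ·) x

lemma sum_bernoulliWeight_not_card_gt (k : ℕ) (x : ℝ) :
    ∑ D : Finset α with ¬ k < #D, bernoulliWeight x D = 1 - binomialTail (Fintype.card α) k x := by
  rw [sum_bernoulliWeight_filter_card (¬ k < ·) x]
  exact eq_sub_of_add_eq' (binomialTail_add_sum_not _ k x)

/-- The indices at which `P` occurs, among i.i.d. variables of law `W`, form a random set that
contains each index independently of the others. -/
lemma sum_prod_mul_apply_filter [DecidableEq ι] (W : κ → R) (P : κ → Prop) [DecidablePred P]
    (f : Finset ι → R) :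
    ∑ e : ι → κ, (∏ a, W (e a)) * f {a | P (e a)} =
      ∑ S : Finset ι, (∏ a, if a ∈ S then ∑ b with P b, W b else ∑ b with ¬ P b, W b) * f S := by
  classical
  rw [← sum_fiberwise univ fun e : ι → κ => ({a | P (e a)} : Finset ι)]
  refine sum_congr rfl fun S _ => ?_
  have fiber_eq_pi : ({e | ({a | P (e a)} : Finset ι) = S} : Finset (ι → κ)) =
      Fintype.piFinset fun a => if a ∈ S then univ.filter P else univ.filter (¬ P ·) := by
    ext e
    simp only [mem_filter, mem_univ, true_and, Fintype.mem_piFinset, Finset.ext_iff]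
    refine forall_congr' fun a => ?_
    by_cases ha : a ∈ S <;> simp [ha]
  have factor : ∀ a, (if a ∈ S then ∑ b with P b, W b else ∑ b with ¬ P b, W b) =
      ∑ b ∈ if a ∈ S then univ.filter P else univ.filter (¬ P ·), W b := fun a =>
    (apply_ite (fun s : Finset κ => ∑ b ∈ s, W b) _ _ _).symm
  simp only [factor, prod_univ_sum, sum_mul, ← fiber_eq_pi]
  refine sum_congr rfl fun e he => ?_
  rw [(mem_filter.1 he).2]

open Classical in
/-- The kernel column of `E` over the remaining coordinates `a'`. -/
noncomputable def fiber (E : Finset (Fin (n + 1) → α)) (a' : Fin n → α) : Finset α :=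
  {a | (Fin.cons a a' : Fin (n + 1) → α) ∈ E}

lemma mem_fiber {E : Finset (Fin (n + 1) → α)} {a' : Fin n → α} {a : α} :
    a ∈ fiber E a' ↔ (Fin.cons a a' : Fin (n + 1) → α) ∈ E := by
  simp [fiber]

/-- A set of positions amounts to its family of kernel columns. -/
noncomputable def fiberEquiv (α : Type*) [Fintype α] (n : ℕ) :
    Finset (Fin (n + 1) → α) ≃ ((Fin n → α) → Finset α) where
  toFun := fiber
  invFun e := by classical exact {b | b 0 ∈ e (Fin.tail b)}
  left_inv E := by
    ext b
    simp [mem_fiber]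
  right_inv e := by
    ext a' a
    simp [mem_fiber]

/-- The kernel columns with more than `k` erased positions; these are the erased positions that an
effective channel with first digit `k` presents to the remaining digits. -/
noncomputable def heavyColumns (k : ℕ) (E : Finset (Fin (n + 1) → α)) : Finset (Fin n → α) :=
  {a' | k < #(fiber E a')}

lemma mem_heavyColumns {k : ℕ} {E : Finset (Fin (n + 1) → α)} {a' : Fin n → α} :
    a' ∈ heavyColumns k E ↔ k < #(fiber E a') := by
  simp [heavyColumns]

lemma bernoulliWeight_eq_prod_fiber (x : ℝ) (E : Finset (Fin (n + 1) → α)) :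
    bernoulliWeight x E = ∏ a', bernoulliWeight x (fiber E a') := by
  classical
  simp only [← prod_ite_mem_eq_bernoulliWeight, mem_fiber]
  rw [← (Fin.consEquiv fun _ => α).prod_comp, Fintype.prod_prod_type_right]
  rfl

lemma sum_bernoulliWeight_mul_apply_heavyColumns (k : ℕ) (x : ℝ)
    (f : Finset (Fin n → α) → ℝ) :
    ∑ E, bernoulliWeight x E * f (heavyColumns k E) =
      ∑ S, bernoulliWeight (binomialTail (Fintype.card α) k x) S * f S := by
  classical
  have independent_columns := sum_prod_mul_apply_filter (ι := Fin n → α)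
    (bernoulliWeight x) (fun D : Finset α => k < #D) f
  simp only [sum_bernoulliWeight_card_gt, sum_bernoulliWeight_not_card_gt,
    prod_ite_mem_eq_bernoulliWeight] at independent_columns
  rw [← independent_columns, ← (fiberEquiv α n).sum_comp]
  simp only [bernoulliWeight_eq_prod_fiber x]
  rfl

end Columns

section Algebra

open Polynomial

variable {F : Type*} [Field F] [Fintype F] {n : ℕ}

/-- The polynomial whose values are the combination of the kernel rows with coefficients `c`. -/
noncomputable def rowPolynomial (c : Fin (Fintype.card F) → F) : F[X] :=
  ∑ i, C (c i) * X ^ (Fintype.card F - 1 - (i : ℕ))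

lemma eval_rowPolynomial (c : Fin (Fintype.card F) → F) (a : F) :
    (rowPolynomial c).eval a = (c ᵥ* kernel F) a := by
  simp [rowPolynomial, eval_finsetSum, kernel, Matrix.vecMul, dotProduct]

lemma coeff_rowPolynomial (c : Fin (Fintype.card F) → F) (i : Fin (Fintype.card F)) :
    (rowPolynomial c).coeff (Fintype.card F - 1 - (i : ℕ)) = c i := by
  simp only [rowPolynomial, finsetSum_coeff, coeff_C_mul, coeff_X_pow]
  rw [sum_eq_single i]
  · simp
  · intro k _ hk
    have : (k : ℕ) ≠ i := Fin.val_ne_of_ne hk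
    rw [if_neg (by omega), mul_zero]
  · simp

lemma natDegree_rowPolynomial_le {c : Fin (Fintype.card F) → F} {i : ℕ}
    (hc : ∀ k : Fin (Fintype.card F), (k : ℕ) < i → c k = 0) :
    (rowPolynomial c).natDegree ≤ Fintype.card F - 1 - i := by
  refine natDegree_sum_le_of_forall_le _ _ fun k _ => ?_
  rcases lt_or_ge (k : ℕ) i with hk | hk
  · simp [hc k hk]
  · exact (natDegree_C_mul_X_pow_le _ _).trans (by omega)

lemma eq_zero_of_vecMul_kernel_eq_zero {c : Fin (Fintype.card F) → F} {i : ℕ}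
    (hi : i < Fintype.card F) (hc : ∀ k : Fin (Fintype.card F), (k : ℕ) < i → c k = 0)
    {D : Finset F} (hD : #D ≤ i)
    (hvanish : ∀ a ∉ D, (c ᵥ* kernel F) a = 0) : c = 0 := by
  classical
  have hpoly : rowPolynomial c = 0 := by
    refine eq_zero_of_natDegree_lt_card_of_eval_eq_zero' _ Dᶜ (fun a ha => ?_) ?_
    · rw [eval_rowPolynomial]
      exact hvanish a (mem_compl.1 ha)
    · refine (natDegree_rowPolynomial_le hc).trans_lt ?_
      rw [card_compl]
      omega
  ext k
  rw [← coeff_rowPolynomial c k, hpoly, coeff_zero, Pi.zero_apply]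

lemma vecMul_kernel_surjective :
    Function.Surjective fun c : Fin (Fintype.card F) → F => c ᵥ* kernel F := by
  classical
  have hinj : Function.Injective (kernel F).vecMulLinear :=
    (injective_iff_map_eq_zero _).2 fun c hc =>
      eq_zero_of_vecMul_kernel_eq_zero (D := ∅) Fintype.card_pos (by simp) le_rfl
        fun a _ => congrFun hc a
  exact ((Fintype.bijective_iff_injective_and_card _).2 ⟨hinj, by simp⟩).surjective

lemma vecMul_kernel_coeff {p : F[X]} (hp : p.natDegree < Fintype.card F) (a : F) :
    ((fun i : Fin (Fintype.card F) => p.coeff (Fintype.card F - 1 - i)) ᵥ* kernel F) a =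
      p.eval a := by
  rw [eval_eq_sum_range' hp, ← sum_range_reflect,
    ← Fin.sum_univ_eq_sum_range
      (fun i => p.coeff (Fintype.card F - 1 - i) * a ^ (Fintype.card F - 1 - i))]
  rfl

lemma exists_vecMul_kernel_eq_zero (i : Fin (Fintype.card F)) {D : Finset F} (hD : (i : ℕ) < #D)
    (w : F) : ∃ c : Fin (Fintype.card F) → F, (∀ k < i, c k = 0) ∧ c i = w ∧
      ∀ a ∉ D, (c ᵥ* kernel F) a = 0 := by
  classical
  have := i.2
  obtain ⟨S, hDS, -, hS⟩ := exists_subsuperset_card_eq (subset_univ Dᶜ)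
    (n := Fintype.card F - 1 - (i : ℕ)) (by rw [card_compl]; omega) (by rw [card_univ]; omega)
  set p : F[X] := ∏ b ∈ S, (X - C b)
  have hdeg : p.natDegree = Fintype.card F - 1 - (i : ℕ) := by
    rw [natDegree_finsetProd_X_sub_C_eq_card, hS]
  have hmonic : p.coeff (Fintype.card F - 1 - (i : ℕ)) = 1 :=
    hdeg ▸ monic_prod_X_sub_C (fun b => b) S
  refine ⟨fun k => w * p.coeff (Fintype.card F - 1 - k), fun k hk => ?_, ?_, fun a ha => ?_⟩
  · have : (k : ℕ) < i := hk
    dsimp only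
    rw [coeff_eq_zero_of_natDegree_lt (by omega), mul_zero]
  · dsimp only
    rw [hmonic, mul_one]
  · have hroot : p.eval a = 0 := by
      rw [eval_prod]
      exact prod_eq_zero (hDS (mem_compl.2 ha)) (by simp)
    have hsmul := congrFun (Matrix.smul_vecMul w
      (fun k : Fin (Fintype.card F) => p.coeff (Fintype.card F - 1 - k)) (kernel F)) a
    rwa [Pi.smul_apply, vecMul_kernel_coeff (by omega), hroot, smul_zero] at hsmul

lemma transform_cons (i : Fin (Fintype.card F)) (i' : Fin n → Fin (Fintype.card F))
    (a : F) (a' : Fin n → F) :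
    transform F (n + 1) (Fin.cons i i') (Fin.cons a a') = kernel F i a * transform F n i' a' := by
  simp [transform, Fin.prod_univ_succ]

lemma vecMul_transform_cons (u : (Fin (n + 1) → Fin (Fintype.card F)) → F) (a : F)
    (a' : Fin n → F) :
    (u ᵥ* transform F (n + 1)) (Fin.cons a a') =
      ((fun i => ((fun i' => u (Fin.cons i i')) ᵥ* transform F n) a') ᵥ* kernel F) a := by
  simp only [Matrix.vecMul, dotProduct, sum_mul]
  rw [← (Fin.consEquiv fun _ => Fin (Fintype.card F)).sum_comp, Fintype.sum_prod_type]
  refine sum_congr rfl fun i _ => sum_congr rfl fun i' _ => ?_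
  rw [mul_right_comm, mul_assoc, ← transform_cons]
  rfl

lemma vecMul_transform_bijective (n : ℕ) :
    Function.Bijective fun u : (Fin n → Fin (Fintype.card F)) → F => u ᵥ* transform F n := by
  classical
  refine (Fintype.bijective_iff_surjective_and_card _).2 ⟨?_, by simp⟩
  induction n with
  | zero =>
    refine fun w => ⟨fun _ => w default, funext fun a => ?_⟩
    simp [Matrix.vecMul, dotProduct, transform, Subsingleton.elim a default]
  | succ n ih =>
    intro w
    choose c hc using fun a' : Fin n → F =>
      vecMul_kernel_surjective fun a => w (Fin.cons a a')
    choose v hv using fun i => ih fun a' => c a' i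
    refine ⟨fun i => v (i 0) (Fin.tail i), funext fun b => ?_⟩
    rw [← Fin.cons_self_tail b]
    simp only [vecMul_transform_cons, Fin.cons_zero, Fin.tail_cons]
    refine (congrFun (congrArg (· ᵥ* kernel F) (funext fun i => ?_)) _).trans
      (congrFun (hc (Fin.tail b)) (b 0))
    exact congrFun (hv i) _

lemma inputErased_iff {E : Finset (Fin n → F)} {j : Fin n → Fin (Fintype.card F)} :
    InputErased E j ↔ ∃ u : (Fin n → Fin (Fintype.card F)) → F,
      (∀ i, toLex i < toLex j → u i = 0) ∧ (∀ a ∉ E, (u ᵥ* transform F n) a = 0) ∧ u j ≠ 0 := by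
  constructor
  · rintro ⟨u, u', hpast, hcode, hj⟩
    refine ⟨u - u', fun i hi => sub_eq_zero.2 (hpast i hi), fun a ha => ?_, sub_ne_zero.2 hj⟩
    rw [Matrix.sub_vecMul, Pi.sub_apply, hcode a ha, sub_self]
  · rintro ⟨u, hpast, hcode, hj⟩
    exact ⟨u, 0, hpast, fun a ha => by rw [hcode a ha, Matrix.zero_vecMul, Pi.zero_apply], hj⟩

lemma toLex_cons_lt {α : Type*} [Preorder α] {a b : α} {v w : Fin n → α} :
    toLex (Fin.cons a v : Fin (n + 1) → α) < toLex (Fin.cons b w : Fin (n + 1) → α) ↔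
      a < b ∨ a = b ∧ toLex v < toLex w :=
  Fin.pi_lex_lt_cons_cons (α := fun _ => α) (· < ·)

lemma InputErased.heavyColumns_of_cons {E : Finset (Fin (n + 1) → F)}
    {i : Fin (Fintype.card F)} {j : Fin n → Fin (Fintype.card F)}
    (h : InputErased E (Fin.cons i j)) : InputErased (heavyColumns i E) j := by
  obtain ⟨u, hpast, hcode, hj⟩ := inputErased_iff.1 h
  refine inputErased_iff.2 ⟨fun i' => u (Fin.cons i i'),
    fun i' hi' => hpast _ (toLex_cons_lt.2 (Or.inr ⟨rfl, hi'⟩)), fun a' ha' => ?_, hj⟩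
  have earlier_rows : ∀ k : Fin (Fintype.card F), k < i → (fun i' => u (Fin.cons k i')) = 0 :=
    fun k hk => funext fun i' => hpast _ (toLex_cons_lt.2 (Or.inl hk))
  rw [mem_heavyColumns, not_lt] at ha'
  refine congrFun (eq_zero_of_vecMul_kernel_eq_zero
    (c := fun k => ((fun i' => u (Fin.cons k i')) ᵥ* transform F n) a') i.2
    (fun k hk => ?_) ha' fun a ha => ?_) i
  · rw [earlier_rows k hk, Matrix.zero_vecMul, Pi.zero_apply]
  · rw [← vecMul_transform_cons]
    exact hcode _ fun h => ha (mem_fiber.2 h)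

lemma InputErased.cons_of_heavyColumns {E : Finset (Fin (n + 1) → F)}
    {i : Fin (Fintype.card F)} {j : Fin n → Fin (Fintype.card F)}
    (h : InputErased (heavyColumns i E) j) : InputErased E (Fin.cons i j) := by
  obtain ⟨u, hpast, hcode, hj⟩ := inputErased_iff.1 h
  -- The combined inputs of the columns may be prescribed freely, as `transform F n` is invertible.
  have exists_column : ∀ a' : Fin n → F, ∃ c : Fin (Fintype.card F) → F, (∀ k < i, c k = 0) ∧
      c i = (u ᵥ* transform F n) a' ∧ ∀ a ∉ fiber E a', (c ᵥ* kernel F) a = 0 := fun a' => by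
    by_cases ha' : a' ∈ heavyColumns i E
    · exact exists_vecMul_kernel_eq_zero i (mem_heavyColumns.1 ha') _
    · exact ⟨0, fun _ _ => rfl, (hcode a' ha').symm, fun a _ => by
        rw [Matrix.zero_vecMul, Pi.zero_apply]⟩
  choose c hc_earlier hc_i hc_vanish using exists_column
  choose v hv using fun k => (vecMul_transform_bijective n).surjective fun a' => c a' k
  have hv_earlier : ∀ k < i, v k = 0 := fun k hk =>
    (vecMul_transform_bijective n).injective (by
      simp only [hv, Matrix.zero_vecMul]
      exact funext fun a' => hc_earlier a' k hk)
  have hv_i : v i = u := (vecMul_transform_bijective n).injective (by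
    simp only [hv]
    exact funext hc_i)
  refine inputErased_iff.2 ⟨fun b => v (b 0) (Fin.tail b), fun b hb => ?_, fun b hb => ?_, ?_⟩
  · rw [← Fin.cons_self_tail b] at hb
    dsimp only
    rcases toLex_cons_lt.1 hb with hlt | ⟨heq, hlt⟩
    · rw [hv_earlier _ hlt, Pi.zero_apply]
    · rw [heq, hv_i, hpast _ hlt]
  · rw [← Fin.cons_self_tail b] at hb ⊢
    rw [vecMul_transform_cons]
    have hcolumn := hc_vanish _ _ (mt mem_fiber.1 hb)
    simpa only [Fin.cons_zero, Fin.tail_cons, hv] using hcolumn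
  · simpa only [Fin.cons_zero, Fin.tail_cons, hv_i] using hj

lemma inputErased_cons {E : Finset (Fin (n + 1) → F)} {i : Fin (Fintype.card F)}
    {j : Fin n → Fin (Fintype.card F)} :
    InputErased E (Fin.cons i j) ↔ InputErased (heavyColumns i E) j :=
  ⟨InputErased.heavyColumns_of_cons, InputErased.cons_of_heavyColumns⟩

end Algebra

section Recursion

variable {F : Type*} [Field F] [Fintype F] {n : ℕ} {x : ℝ}

open Classical in
lemma erasureRate_eq_sum_bernoulliWeight (n : ℕ) (x : ℝ) (j : Fin n → Fin (Fintype.card F)) :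
    erasureRate (F := F) n x j =
      ∑ E, bernoulliWeight x E * if InputErased E j then 1 else 0 := by
  simp only [erasureRate, bernoulliWeight, card_compl]

lemma inputErased_zero {E : Finset (Fin 0 → F)} {j : Fin 0 → Fin (Fintype.card F)} :
    InputErased E j ↔ E = univ := by
  have vecMul_eq : ∀ (u : (Fin 0 → Fin (Fintype.card F)) → F) a, (u ᵥ* transform F 0) a = u j :=
    fun u a => by rw [Matrix.vecMul, dotProduct, Fintype.sum_subsingleton _ j]; simp [transform]
  simp only [inputErased_iff, vecMul_eq, eq_univ_iff_forall]
  constructor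
  · rintro ⟨u, -, hcode, hj⟩ a
    exact by_contra fun ha => hj (hcode a ha)
  · exact fun hE => ⟨1, fun i hi => absurd (congrArg toLex (Subsingleton.elim i j)) hi.ne,
      fun a ha => absurd (hE a) ha, one_ne_zero⟩

lemma erasureRate_zero (x : ℝ) (j : Fin 0 → Fin (Fintype.card F)) :
    erasureRate (F := F) 0 x j = x := by
  simp [erasureRate_eq_sum_bernoulliWeight, inputErased_zero, bernoulliWeight]

lemma erasureRate_cons (x : ℝ) (i : Fin (Fintype.card F)) (j : Fin n → Fin (Fintype.card F)) :
    erasureRate (F := F) (n + 1) x (Fin.cons i j) =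
      erasureRate (F := F) n (binomialTail (Fintype.card F) i x) j := by
  classical
  simp only [erasureRate_eq_sum_bernoulliWeight, inputErased_cons]
  exact sum_bernoulliWeight_mul_apply_heavyColumns i x fun S => if InputErased S j then 1 else 0

lemma sum_apply_erasureRate_succ (n : ℕ) (x : ℝ) (g : ℝ → ℝ) :
    ∑ j, g (erasureRate (F := F) (n + 1) x j) =
      ∑ i ∈ range (Fintype.card F),
        ∑ j, g (erasureRate (F := F) n (binomialTail (Fintype.card F) i x) j) := by
  rw [← (Fin.consEquiv fun _ => Fin (Fintype.card F)).sum_comp, Fintype.sum_prod_type,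
    ← Fin.sum_univ_eq_sum_range
      (fun i => ∑ j, g (erasureRate (F := F) n (binomialTail (Fintype.card F) i x) j))]
  refine sum_congr rfl fun i _ => sum_congr rfl fun j _ => ?_
  rw [← erasureRate_cons]
  rfl

lemma erasureRate_mem_Icc (n : ℕ) (hx : x ∈ Set.Icc (0 : ℝ) 1)
    (j : Fin n → Fin (Fintype.card F)) : erasureRate (F := F) n x j ∈ Set.Icc (0 : ℝ) 1 := by
  induction n generalizing x with
  | zero => rwa [erasureRate_zero]
  | succ n ih =>
    rw [← Fin.cons_self_tail j, erasureRate_cons]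
    exact ih (binomialTail_mem_Icc hx) _

lemma sum_erasureRate (n : ℕ) (x : ℝ) :
    ∑ j, erasureRate (F := F) n x j = (Fintype.card F : ℝ) ^ n * x := by
  induction n generalizing x with
  | zero => simp [erasureRate_zero]
  | succ n ih =>
    rw [sum_apply_erasureRate_succ n x fun y => y]
    simp only [ih, ← mul_sum, sum_binomialTail, pow_succ, mul_assoc]

lemma sum_apply_erasureRate_le_pow_mul {g : ℝ → ℝ} {c : ℝ} (hc : 0 ≤ c)
    (hstep : ∀ x ∈ Set.Icc (0 : ℝ) 1,
      ∑ i ∈ range (Fintype.card F), g (binomialTail (Fintype.card F) i x) ≤ c * g x)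
    (n : ℕ) (hx : x ∈ Set.Icc (0 : ℝ) 1) :
    ∑ j, g (erasureRate (F := F) n x j) ≤ c ^ n * g x := by
  induction n generalizing x with
  | zero => simp [erasureRate_zero]
  | succ n ih =>
    calc ∑ j, g (erasureRate (F := F) (n + 1) x j)
        = ∑ i ∈ range (Fintype.card F),
            ∑ j, g (erasureRate (F := F) n (binomialTail (Fintype.card F) i x) j) :=
          sum_apply_erasureRate_succ n x g
      _ ≤ ∑ i ∈ range (Fintype.card F), c ^ n * g (binomialTail (Fintype.card F) i x) :=
          sum_le_sum fun i _ => ih (binomialTail_mem_Icc hx)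
      _ ≤ c ^ n * (c * g x) := by
          rw [← mul_sum]
          exact mul_le_mul_of_nonneg_left (hstep x hx) (by positivity)
      _ = c ^ (n + 1) * g x := by ring

end Recursion

section Markov

variable {F : Type*} [Field F] [Fintype F] {x β δ : ℝ}

open Classical in
lemma prob_eq_card_filter_div (n : ℕ) (x : ℝ) (A : Set ℝ) :
    prob F n x A =
      #{j | erasureRate (F := F) n x j ∈ A} / (Fintype.card F : ℝ) ^ n := by
  rw [prob, Nat.card_eq_fintype_card, Fintype.card_subtype]

lemma prob_le_add_of_subset_union (n : ℕ) (x : ℝ) {A B C : Set ℝ} (h : A ⊆ B ∪ C) :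
    prob F n x A ≤ prob F n x B + prob F n x C := by
  classical
  simp only [prob_eq_card_filter_div, ← add_div]
  gcongr
  norm_cast
  refine (card_le_card fun j hj => ?_).trans (card_union_le _ _)
  rw [← filter_or]
  exact mem_filter.2 ⟨mem_univ j, h (mem_filter.1 hj).2⟩

lemma prob_mul_le_sum_div (n : ℕ) (x : ℝ) {A : Set ℝ} {g : ℝ → ℝ} {c : ℝ}
    (hg : ∀ j, 0 ≤ g (erasureRate (F := F) n x j)) (hc : ∀ y ∈ A, c ≤ g y) :
    prob F n x A * c ≤ (∑ j, g (erasureRate (F := F) n x j)) / (Fintype.card F : ℝ) ^ n := by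
  classical
  rw [prob_eq_card_filter_div, div_mul_eq_mul_div, ← nsmul_eq_mul, ← sum_const]
  gcongr
  exact (sum_le_sum fun j hj => hc _ (mem_filter.1 hj).2).trans
    (sum_le_sum_of_subset_of_nonneg (filter_subset _ _) fun j _ _ => hg j)

lemma sum_potential_erasureRate_le (n : ℕ) (hx : x ∈ Set.Icc (0 : ℝ) 1) (h0 : 0 < β)
    (h1 : β ≤ 1 / 2) :
    ∑ j, potential β (erasureRate (F := F) n x j) ≤
      (Fintype.card F * driftFactor (Fintype.card F) β) ^ n * (1 / 4) ^ β := by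
  have hfactor : 0 ≤ Fintype.card F * driftFactor (Fintype.card F) β :=
    mul_nonneg (Nat.cast_nonneg _) (driftFactor_nonneg _ _)
  refine (sum_apply_erasureRate_le_pow_mul hfactor
    (fun y hy => sum_potential_binomialTail_le_driftFactor hy h0 h1) n hx).trans ?_
  exact mul_le_mul_of_nonneg_left (potential_le_one_quarter_rpow hx h0.le) (pow_nonneg hfactor n)

lemma prob_Icc_le (n : ℕ) (hx : x ∈ Set.Icc (0 : ℝ) 1) (h0 : 0 < β) (h1 : β ≤ 1 / 2)
    (hδ0 : 0 < δ) (hδ : δ ≤ 3 / 4) :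
    prob F n x (Set.Icc δ (1 - δ)) ≤ driftFactor (Fintype.card F) β ^ n * δ ^ (-β) := by
  have hN : (0 : ℝ) < (Fintype.card F : ℝ) ^ n := pow_pos (Nat.cast_pos.2 Fintype.card_pos) n
  have hquarter : (0 : ℝ) < (1 / 4) ^ β := by positivity
  have markov : prob F n x (Set.Icc δ (1 - δ)) * (δ / 4) ^ β ≤
      driftFactor (Fintype.card F) β ^ n * (1 / 4) ^ β :=
    calc prob F n x (Set.Icc δ (1 - δ)) * (δ / 4) ^ β
        ≤ (∑ j, potential β (erasureRate (F := F) n x j)) / (Fintype.card F : ℝ) ^ n :=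
          prob_mul_le_sum_div n x (fun j => potential_nonneg (erasureRate_mem_Icc n hx j))
            fun y hy => div_four_rpow_le_potential hδ0.le hδ hy h0.le
      _ ≤ driftFactor (Fintype.card F) β ^ n * (1 / 4) ^ β := by
          rw [div_le_iff₀' hN, ← mul_assoc, ← mul_pow]
          exact sum_potential_erasureRate_le n hx h0 h1
  rw [div_eq_mul_one_div, mul_rpow hδ0.le (by norm_num), ← mul_assoc] at markov
  rw [rpow_neg hδ0.le, ← div_eq_mul_inv, le_div_iff₀ (by positivity)]
  exact le_of_mul_le_mul_right markov hquarter

lemma prob_Ici_le (n : ℕ) (hx : x ∈ Set.Icc (0 : ℝ) 1) (hδ : 0 < δ) :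
    prob F n x (Set.Ici δ) ≤ x / δ := by
  have hN : (Fintype.card F : ℝ) ^ n ≠ 0 :=
    pow_ne_zero n (Nat.cast_ne_zero.2 Fintype.card_ne_zero)
  rw [le_div_iff₀ hδ]
  calc prob F n x (Set.Ici δ) * δ
      ≤ (∑ j, erasureRate (F := F) n x j) / (Fintype.card F : ℝ) ^ n :=
        prob_mul_le_sum_div n x (g := fun y => y) (fun j => (erasureRate_mem_Icc n hx j).1)
          fun _ hy => hy
    _ = x := by rw [sum_erasureRate, mul_div_cancel_left₀ x hN]

lemma driftFactor_eq_rpow {q : ℝ} (hq : 1 < q) (h0 : 0 < β) :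
    driftFactor q β = q ^ (-(1 / 2) +
      (log 6 - 1 / 2 * log β + (β - 1 / 2) * log 4) / log q) := by
  have hq0 : 0 < q := by linarith
  have hlogq : log q ≠ 0 := (log_pos hq).ne'
  have log_six : log 6 = log 2 + log 3 := by
    rw [← log_mul two_ne_zero three_ne_zero]
    norm_num
  have log_driftFactor : log (driftFactor q β) =
      log 3 + β * log 4 - (log β / 2 + log q / 2) := by
    rw [driftFactor, log_div (by positivity) (by positivity),
      log_mul (by positivity) (by positivity), log_mul (by positivity) (by positivity),
      log_rpow (by norm_num), log_sqrt h0.le, log_sqrt hq0.le]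
  have hpos : 0 < driftFactor q β := by
    rw [driftFactor]
    positivity
  rw [← exp_log hpos, log_driftFactor, rpow_def_of_pos hq0, mul_add, mul_div_cancel₀ _ hlogq,
    log_six, log_four_eq]
  ring_nf

lemma driftFactor_pow_mul_rpow {q : ℝ} (hq : 1 < q) (h0 : 0 < β) (γ : ℝ) (n : ℕ) :
    driftFactor q β ^ n * ((q ^ n) ^ (-γ)) ^ (-β) =
      (q ^ n) ^ (γ * β - 1 / 2 +
        (log 6 - 1 / 2 * log β + (β - 1 / 2) * log 4) / log q) := by
  have hq0 : 0 < q := by linarith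
  rw [driftFactor_eq_rpow hq h0, rpow_pow_comm hq0.le, ← rpow_mul (by positivity),
    ← rpow_add (by positivity)]
  ring_nf

end Markov

end RSPolar

theorem theorem1 (F : Type*) [Field F] [Fintype F] (q : ℕ) (hq : q = Fintype.card F)
    (n : ℕ) (N : ℝ) (hN : N = (q : ℝ) ^ n) (γ β x : ℝ) (hγ : 0 < γ) (hβ : β ∈ Set.Ioc (0 : ℝ) (1 / 2))
    (hNγ : N ^ (-γ) ≤ 3 / 4) (hx : x ∈ Set.Icc (0 : ℝ) 1) :
    RSPolar.prob F n x (Set.Icc (N ^ (-γ)) (1 - N ^ (-γ))) ≤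
        N ^ (γ * β - 1 / 2 +
          (Real.log 6 - 1 / 2 * Real.log β + (β - 1 / 2) * Real.log 4) / Real.log q) ∧
    RSPolar.prob F n x (Set.Ici (N ^ (-γ))) ≤
        N ^ (γ * β - 1 / 2 +
          (Real.log 6 - 1 / 2 * Real.log β + (β - 1 / 2) * Real.log 4) / Real.log q) +
        x / (1 - N ^ (-γ)) := by
  have hq1 : (1 : ℝ) < q := hq ▸ Nat.one_lt_cast.2 Fintype.one_lt_card
  have hδ : 0 < N ^ (-γ) := Real.rpow_pos_of_pos (hN ▸ by positivity) _
  have middle := RSPolar.prob_Icc_le (F := F) n hx hβ.1 hβ.2 hδ hNγ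
  have upper := RSPolar.prob_Ici_le (F := F) n hx (by linarith : 0 < 1 - N ^ (-γ))
  have split := RSPolar.prob_le_add_of_subset_union (F := F) n x
    fun y (hy : N ^ (-γ) ≤ y) => (le_total y (1 - N ^ (-γ))).imp_left (And.intro hy)
  rw [← hq, hN, RSPolar.driftFactor_pow_mul_rpow hq1 hβ.1, ← hN] at middle
  exact ⟨middle, split.trans (add_le_add middle upper)⟩
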